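/- Let $Z\sim\mathcal N(0,1)$, and for a probability measure $P$ on $\mathbb R$ let $I(P):=I(X;Y)=D(P_{XY}\,\|\,P_X\otimes P_Y)$ (natural logarithm) be the mutual information between $X\sim P$ and $Y=X+Z$, where $Z$ is independent of $X$. Let $\mathrm{supp}(P)$ be the set of points all of whose open neighbourhoods have positive $P$-measure. Fix $A>0$, and put $$C(A):=\sup\{I(P):\ \mathrm{supp}(P)\subset[-A,A]\}.$$ For $\varepsilon>0$ put $$K_\varepsilon(A):=\min\{|\mathrm{supp}(P)|:\ \mathrm{supp}(P)\subset[-A,A],\ P\text{ discrete},\ I(P)\ge C(A)-\varepsilon\}.$$ Then $C(A)<\infty$, and there is exactly one probability measure $P_{X^*}$ with $\mathrm{supp}(P_{X^*})\subset[-A,A]$ and $I(P_{X^*})=C(A)$ (the capacity-achieving input distribution). Moreover: 1. For every $\varepsilon>0$, the minimum defining $K_\varepsilon(A)$ is attained, and $$1\le K_\varepsilon(A)\le|\mathrm{supp}(P_{X^*})|<\infty .$$ 2. The map $\varepsilon\mapsto K_\varepsilon(A)$ is non-increasing on $(0,\infty)$. 3. For an integer $m$ with $1\le m<|\mathrm{supp}(P_{X^*})|$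 let $$C_{-m}(A):=\sup\{I(P):\ \mathrm{supp}(P)\subset[-A,A],\ P\text{ discrete},\ |\mathrm{supp}(P)|\le|\mathrm{supp}(P_{X^*})|-m\}$$ and $\delta_m(A):=C(A)-C_{-m}(A)$. Then for every $0<\varepsilon<\delta_m(A)$, $$K_\varepsilon(A)\ge|\mathrm{supp}(P_{X^*})|-m+1 .$$ 4. Consequently, $\displaystyle\lim_{\varepsilon\downarrow0}K_\varepsilon(A)=|\mathrm{supp}(P_{X^*})|$. -/

import Mathlib

open MeasureTheory ProbabilityTheory Set Filter
open scoped ENNReal Topology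

noncomputable section

namespace AmplitudeAWGN

/-- Mutual information `I(X;Y) = D(P_{XY} ‖ P_X ⊗ P_Y)` (natural logarithm) of a pair of random
variables with joint law `ρ`; here `ρ.fst = P_X` and `ρ.snd = P_Y`. -/
def mutualInfo (ρ : Measure (ℝ × ℝ)) : ℝ≥0∞ :=
  InformationTheory.klDiv ρ (ρ.fst.prod ρ.snd)

/-- Joint law of `(X, Y)` where `Y = X + Z`, `X ∼ P`, and `Z` is a standard normal random variable
independent of `X`. -/
def jointLaw (P : Measure ℝ) : Measure (ℝ × ℝ) :=
  (P.prod (gaussianReal 0 1)).map (fun p : ℝ × ℝ => (p.1, p.1 + p.2))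

/-- `I(X; X + Z)` for an input `X ∼ P`. -/
def info (P : Measure ℝ) : ℝ≥0∞ := mutualInfo (jointLaw P)

/-- `P` is an admissible input law: a probability measure on `ℝ` with support in `[-A, A]`. -/
def IsInput (A : ℝ) (P : Measure ℝ) : Prop :=
  IsProbabilityMeasure P ∧ P.support ⊆ Icc (-A) A

/-- `P` is discrete: it is carried by a countable set. -/
def IsDiscreteLaw (P : Measure ℝ) : Prop :=
  ∃ S : Set ℝ, S.Countable ∧ P Sᶜ = 0

/-- The capacity `C(A)`: the supremum of `I(X;Y)` over all input laws supported in `[-A, A]`. -/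
def capacity (A : ℝ) : ℝ≥0∞ :=
  sSup {I | ∃ P : Measure ℝ, IsInput A P ∧ I = info P}

/-- `P` is a capacity-achieving input law. -/
def IsCapacityAchieving (A : ℝ) (P : Measure ℝ) : Prop :=
  IsInput A P ∧ info P = capacity A

/-- The support sizes `|supp P|` of the discrete input laws `P` on `[-A, A]` with
`I(X;Y) ≥ C(A) - ε`. (The subtraction is truncated at `0`, which changes nothing since
`I(X;Y) ≥ 0`.) -/
def nearOptimalSizes (ε A : ℝ) : Set ℕ∞ :=
  {k | ∃ P : Measure ℝ, IsInput A P ∧ IsDiscreteLaw P ∧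
    capacity A - ENNReal.ofReal ε ≤ info P ∧ k = P.support.encard}

/-- `K_ε(A)`: the smallest element of `nearOptimalSizes ε A`. -/
def K (ε A : ℝ) : ℕ∞ := sInf (nearOptimalSizes ε A)

/-- The supremum of `I(X;Y)` over the discrete input laws on `[-A, A]` with at most `n` support
points. -/
def capacityAtMost (A : ℝ) (n : ℕ∞) : ℝ≥0∞ :=
  sSup {I | ∃ P : Measure ℝ, IsInput A P ∧ IsDiscreteLaw P ∧ P.support.encard ≤ n ∧ I = info P}

/-- `C_{-m}(A)`, where `Pstar` is the capacity-achieving input law. -/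
def capacityMinus (A : ℝ) (Pstar : Measure ℝ) (m : ℕ) : ℝ≥0∞ :=
  capacityAtMost A (Pstar.support.encard - m)

/-- `δ_m(A) = C(A) - C_{-m}(A)`; no truncation occurs since `C_{-m}(A) ≤ C(A)`. -/
def gap (A : ℝ) (Pstar : Measure ℝ) (m : ℕ) : ℝ≥0∞ :=
  capacity A - capacityMinus A Pstar m

end AmplitudeAWGN

end

/-!
The proof follows Smith's argument for the amplitude-constrained Gaussian channel. Write `f_P` for
the output density of an input `P`. For inputs on `[-A, A]` the output densities lie between two
Gaussian-type envelopes, so `-log f_P` lies between two quadratics and every integral below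
converges. The mutual information is `crossEntropy P P` (the output entropy) minus the entropy of
the noise, where `crossEntropy P Q = -∫ f_P log f_Q`.

* Existence: the inputs are weakly compact by Prokhorov's theorem, and the output entropy is weakly
  continuous by dominated convergence (`continuousOn_crossEntropy`).
* Uniqueness: `crossEntropy` is affine in its first argument and, by Gibbs' inequality, minimal at
  `Q = P` in its second. Two maximizers therefore have the same output density as their midpoint,
  and the output density determines the input since the Gaussian characteristic function has no
  zeros (`IsInput.eq_of_forall_le`).
* Finite support: at a maximizer `P`, moving mass to a point `x` cannot increase the entropy, so
  `crossEntropy δ_x P ≤ crossEntropy P P` on `[-A, A]`, with equality on the support. The left-hand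
  side is analytic in `x`, so an infinite support would make it constant on `ℝ`; but it grows
  quadratically (`IsInput.finite_support`).
* Support sizes: if the maximizer has `n` support points, the inputs that miss one of `n` given
  disjoint neighbourhoods of these points form a compact set not containing it. Their entropy stays
  below the maximum by some `δ > 0`, so an input within less than `δ` of the capacity has at least
  `n` support points (`IsInput.exists_forall_encard_support_le`). This gives the limit of `K_ε`; the
  remaining claims about `K_ε` are order-theoretic, because `ℕ∞` is well-ordered and the maximizer
  itself, having finite support, is discrete.
-/

namespace AmplitudeAWGN

/-! ### Output densities and cross entropies of inputs on a bounded interval -/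

theorem isInput_iff_ae {A : ℝ} {P : Measure ℝ} :
    IsInput A P ↔ IsProbabilityMeasure P ∧ ∀ᵐ x ∂P, |x| ≤ A := by
  have key : ∀ x : ℝ, x ∈ Icc (-A) A ↔ |x| ≤ A := fun x => by rw [abs_le]; rfl
  refine and_congr_right fun _ => ⟨fun h => ?_, fun h => ?_⟩
  · filter_upwards [P.support_mem_ae] with x hx using (key x).1 (h hx)
  · exact Measure.support_subset_of_isClosed isClosed_Icc (h.mono fun x hx => (key x).2 hx)

theorem IsInput.mono {A B : ℝ} {P : Measure ℝ} (h : IsInput A P) (hAB : A ≤ B) : IsInput B P := by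
  rw [isInput_iff_ae] at h ⊢
  exact ⟨h.1, h.2.mono fun x hx => hx.trans hAB⟩

theorem isInput_dirac {A x : ℝ} (h : |x| ≤ A) : IsInput A (Measure.dirac x) := by
  rw [isInput_iff_ae]
  refine ⟨inferInstance, ?_⟩
  rw [ae_dirac_eq]
  exact h

/-- The density of the output `Y = X + Z` for an input `X ∼ P`. -/
noncomputable def outDensity (P : Measure ℝ) (y : ℝ) : ℝ := ∫ x, gaussianPDFReal x 1 y ∂P

/-- The surprisal `-log f` of the output density `f` of the input `P`. -/
noncomputable def surprisal (P : Measure ℝ) (y : ℝ) : ℝ := -Real.log (outDensity P y)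

/-- The cross entropy of the output law of the input `P` relative to that of the input `Q`.
For `P = Q` it is the differential entropy of the output. -/
noncomputable def crossEntropy (P Q : Measure ℝ) : ℝ := ∫ y, surprisal Q y * outDensity P y

/-- The maximum of the standard normal density. -/
noncomputable def peak : ℝ := (√(2 * Real.pi))⁻¹

theorem peak_pos : 0 < peak := by unfold peak; positivity

theorem peak_le_one : peak ≤ 1 := by
  refine inv_le_one_of_one_le₀ (Real.one_le_sqrt.2 ?_)
  linarith [Real.pi_gt_three]

theorem gaussianPDFReal_one (x y : ℝ) :
    gaussianPDFReal x 1 y = peak * Real.exp (-(y - x) ^ 2 / 2) := by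
  simp [gaussianPDFReal, peak]

theorem gaussianPDFReal_le_peak (x y : ℝ) : gaussianPDFReal x 1 y ≤ peak := by
  rw [gaussianPDFReal_one]
  refine mul_le_of_le_one_right peak_pos.le (Real.exp_le_one_iff.2 ?_)
  nlinarith [sq_nonneg (y - x)]

theorem measurable_gaussianPDFReal_uncurry :
    Measurable fun p : ℝ × ℝ => gaussianPDFReal p.1 1 p.2 := by
  simp only [gaussianPDFReal_one]
  fun_prop

theorem gaussianPDFReal_le_envelope {A x : ℝ} (hx : |x| ≤ A) (y : ℝ) :
    gaussianPDFReal x 1 y ≤ peak * Real.exp (A ^ 2 / 2 - y ^ 2 / 4) := by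
  rw [gaussianPDFReal_one]
  refine mul_le_mul_of_nonneg_left (Real.exp_le_exp.2 ?_) peak_pos.le
  nlinarith [sq_nonneg (y - 2 * x), sq_abs x, abs_nonneg x]

theorem envelope_le_gaussianPDFReal {A x : ℝ} (hx : |x| ≤ A) (y : ℝ) :
    peak * Real.exp (-A ^ 2 - y ^ 2) ≤ gaussianPDFReal x 1 y := by
  rw [gaussianPDFReal_one]
  refine mul_le_mul_of_nonneg_left (Real.exp_le_exp.2 ?_) peak_pos.le
  nlinarith [sq_nonneg (y + x), sq_abs x, abs_nonneg x]

theorem integrable_gaussianPDFReal_left (P : Measure ℝ) [IsFiniteMeasure P] (y : ℝ) :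
    Integrable (fun x => gaussianPDFReal x 1 y) P := by
  refine Integrable.of_bound
    (measurable_gaussianPDFReal_uncurry.comp measurable_prodMk_right).aestronglyMeasurable peak
    (ae_of_all _ fun x => ?_)
  rw [Real.norm_of_nonneg (gaussianPDFReal_nonneg _ _ _)]
  exact gaussianPDFReal_le_peak x y

theorem measurable_outDensity (P : Measure ℝ) [SFinite P] : Measurable (outDensity P) :=
  (measurable_gaussianPDFReal_uncurry.comp
    measurable_swap).stronglyMeasurable.integral_prod_right'.measurable

theorem measurable_surprisal (P : Measure ℝ) [SFinite P] : Measurable (surprisal P) :=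
  (Real.measurable_log.comp (measurable_outDensity P)).neg

theorem outDensity_le_peak (P : Measure ℝ) [IsProbabilityMeasure P] (y : ℝ) :
    outDensity P y ≤ peak := by
  have h := integral_mono (integrable_gaussianPDFReal_left P y) (integrable_const peak)
    fun x => gaussianPDFReal_le_peak x y
  simpa [outDensity] using h

section Bounds

variable {A : ℝ} {P Q : Measure ℝ}

theorem IsInput.outDensity_le (hP : IsInput A P) (y : ℝ) :
    outDensity P y ≤ peak * Real.exp (A ^ 2 / 2 - y ^ 2 / 4) := by
  obtain ⟨_, h⟩ := isInput_iff_ae.1 hP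
  have := integral_mono_ae (integrable_gaussianPDFReal_left P y) (integrable_const _)
    (h.mono fun x hx => gaussianPDFReal_le_envelope hx y)
  simpa [outDensity] using this

theorem IsInput.le_outDensity (hP : IsInput A P) (y : ℝ) :
    peak * Real.exp (-A ^ 2 - y ^ 2) ≤ outDensity P y := by
  obtain ⟨_, h⟩ := isInput_iff_ae.1 hP
  have := integral_mono_ae (integrable_const _) (integrable_gaussianPDFReal_left P y)
    (h.mono fun x hx => envelope_le_gaussianPDFReal hx y)
  simpa [outDensity] using this

theorem IsInput.outDensity_pos (hP : IsInput A P) (y : ℝ) : 0 < outDensity P y :=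
  (mul_pos peak_pos (Real.exp_pos _)).trans_le (hP.le_outDensity y)

theorem IsInput.surprisal_nonneg (hP : IsInput A P) (y : ℝ) : 0 ≤ surprisal P y := by
  have := hP.1
  exact neg_nonneg.2 (Real.log_nonpos (hP.outDensity_pos y).le
    ((outDensity_le_peak P y).trans peak_le_one))

theorem IsInput.surprisal_le (hP : IsInput A P) (y : ℝ) :
    surprisal P y ≤ (A ^ 2 - Real.log peak) + y ^ 2 := by
  have := Real.log_le_log (mul_pos peak_pos (Real.exp_pos _)) (hP.le_outDensity y)
  rw [Real.log_mul peak_pos.ne' (Real.exp_pos _).ne', Real.log_exp] at this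
  unfold surprisal
  linarith

theorem IsInput.le_surprisal (hP : IsInput A P) (y : ℝ) :
    y ^ 2 / 4 - A ^ 2 / 2 - Real.log peak ≤ surprisal P y := by
  have := Real.log_le_log (hP.outDensity_pos y) (hP.outDensity_le y)
  rw [Real.log_mul peak_pos.ne' (Real.exp_pos _).ne', Real.log_exp] at this
  unfold surprisal
  linarith

theorem integrable_quadratic_mul_envelope (a A : ℝ) :
    Integrable fun y : ℝ => (a + y ^ 2) * (peak * Real.exp (A ^ 2 / 2 - y ^ 2 / 4)) := by
  have h0 := (integrable_exp_neg_mul_sq (b := 1 / 4) (by norm_num)).const_mul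
    (a * peak * Real.exp (A ^ 2 / 2))
  have h2 := (integrable_rpow_mul_exp_neg_mul_sq (b := 1 / 4) (s := 2) (by norm_num)
    (by norm_num)).const_mul (peak * Real.exp (A ^ 2 / 2))
  refine (h0.add h2).congr (ae_of_all _ fun y => ?_)
  simp only [Pi.add_apply, Real.rpow_ofNat]
  rw [show A ^ 2 / 2 - y ^ 2 / 4 = A ^ 2 / 2 + -(1 / 4) * y ^ 2 by ring, Real.exp_add]
  ring

/-- Functions of at most quadratic growth are integrable against the output law. -/
theorem IsInput.integrable_mul_outDensity (hP : IsInput A P) {h : ℝ → ℝ} (hm : Measurable h)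
    {a : ℝ} (hb : ∀ y, |h y| ≤ a + y ^ 2) : Integrable fun y => h y * outDensity P y := by
  have := hP.1
  refine (integrable_quadratic_mul_envelope a A).mono'
    (hm.mul (measurable_outDensity P)).aestronglyMeasurable (ae_of_all _ fun y => ?_)
  rw [norm_mul, Real.norm_eq_abs, Real.norm_of_nonneg (hP.outDensity_pos y).le]
  exact mul_le_mul (hb y) (hP.outDensity_le y) (hP.outDensity_pos y).le
    ((abs_nonneg _).trans (hb y))

theorem IsInput.integrable_prod (hP : IsInput A P) {h : ℝ → ℝ} (hm : Measurable h)
    {a : ℝ} (hb : ∀ y, |h y| ≤ a + y ^ 2) :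
    Integrable (fun p : ℝ × ℝ => h p.2 * gaussianPDFReal p.1 1 p.2) (P.prod volume) := by
  have := hP.1
  have h1 : Integrable (fun p : ℝ × ℝ => (1 : ℝ) *
      ((a + p.2 ^ 2) * (peak * Real.exp (A ^ 2 / 2 - p.2 ^ 2 / 4)))) (P.prod volume) :=
    (integrable_const (1 : ℝ)).mul_prod (integrable_quadratic_mul_envelope a A)
  refine h1.mono' ((hm.comp measurable_snd).mul
    measurable_gaussianPDFReal_uncurry).aestronglyMeasurable ?_
  have h2 : ∀ᵐ p ∂(P.prod (volume : Measure ℝ)), |p.1| ≤ A :=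
    Measure.quasiMeasurePreserving_fst.ae (isInput_iff_ae.1 hP).2
  filter_upwards [h2] with p hp
  rw [norm_mul, Real.norm_eq_abs, Real.norm_of_nonneg (gaussianPDFReal_nonneg _ _ _), one_mul]
  exact mul_le_mul (hb _) (gaussianPDFReal_le_envelope hp _) (gaussianPDFReal_nonneg _ _ _)
    ((abs_nonneg _).trans (hb _))

theorem IsInput.integral_mul_outDensity (hP : IsInput A P) {h : ℝ → ℝ} (hm : Measurable h)
    {a : ℝ} (hb : ∀ y, |h y| ≤ a + y ^ 2) :
    ∫ y, h y * outDensity P y = ∫ x, (∫ y, h y * gaussianPDFReal x 1 y) ∂P := by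
  have := hP.1
  rw [integral_integral_swap (hP.integrable_prod hm hb)]
  simp_rw [integral_const_mul]
  rfl

theorem IsInput.integrable_outDensity (hP : IsInput A P) : Integrable (outDensity P) := by
  have := hP.integrable_mul_outDensity (h := fun _ => 1) (a := 1) measurable_const
    (fun y => by simp; positivity)
  simpa using this

theorem IsInput.integral_outDensity (hP : IsInput A P) : ∫ y, outDensity P y = 1 := by
  have := hP.integral_mul_outDensity (h := fun _ => 1) (a := 1) measurable_const
    (fun y => by simp; positivity)
  have hprob := hP.1
  simpa [integral_gaussianPDFReal_eq_one] using this

theorem IsInput.abs_surprisal_le (hQ : IsInput A Q) (y : ℝ) :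
    |surprisal Q y| ≤ (A ^ 2 - Real.log peak) + y ^ 2 := by
  rw [abs_of_nonneg (hQ.surprisal_nonneg y)]
  exact hQ.surprisal_le y

theorem IsInput.integrable_surprisal_mul (hP : IsInput A P) (hQ : IsInput A Q) :
    Integrable fun y => surprisal Q y * outDensity P y :=
  have := hQ.1
  hP.integrable_mul_outDensity (measurable_surprisal Q) hQ.abs_surprisal_le

theorem outDensity_dirac (x y : ℝ) : outDensity (Measure.dirac x) y = gaussianPDFReal x 1 y := by
  simp [outDensity]

/-- The cross entropy is the average over the input `x ∼ P` of its values at the point masses. -/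
theorem IsInput.crossEntropy_eq_integral_dirac (hP : IsInput A P) (hQ : IsInput A Q) :
    crossEntropy P Q = ∫ x, crossEntropy (Measure.dirac x) Q ∂P := by
  have := hQ.1
  simp only [crossEntropy, outDensity_dirac]
  exact hP.integral_mul_outDensity (measurable_surprisal Q) hQ.abs_surprisal_le

theorem IsInput.integrable_crossEntropy_dirac (hP : IsInput A P) (hQ : IsInput A Q) :
    Integrable (fun x => crossEntropy (Measure.dirac x) Q) P := by
  have := hQ.1
  have := hP.1
  simp only [crossEntropy, outDensity_dirac]
  exact (hP.integrable_prod (measurable_surprisal Q) hQ.abs_surprisal_le).integral_prod_left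

end Bounds

/-! ### Mutual information as output entropy minus noise entropy -/

theorem lintegral_jointLaw (P : Measure ℝ) [IsProbabilityMeasure P] {F : ℝ × ℝ → ℝ≥0∞}
    (hF : Measurable F) :
    ∫⁻ p, F p ∂jointLaw P = ∫⁻ x, (∫⁻ y, F (x, y) ∂gaussianReal x 1) ∂P := by
  rw [jointLaw, lintegral_map hF (by fun_prop), lintegral_prod _ (by fun_prop)]
  refine lintegral_congr fun x => ?_
  have h := gaussianReal_map_const_add (μ := 0) (v := 1) x
  rw [zero_add] at h
  rw [← h, lintegral_map (by fun_prop) (by fun_prop)]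

theorem jointLaw_eq_withDensity (P : Measure ℝ) [IsProbabilityMeasure P] :
    jointLaw P = (P.prod volume).withDensity
      fun p => ENNReal.ofReal (gaussianPDFReal p.1 1 p.2) := by
  have hm := measurable_gaussianPDFReal_uncurry.ennreal_ofReal
  refine Measure.ext_of_lintegral _ fun F hF => ?_
  rw [lintegral_jointLaw P hF, lintegral_withDensity_eq_lintegral_mul _ hm hF,
    lintegral_prod _ (by fun_prop)]
  refine lintegral_congr fun x => ?_
  rw [gaussianReal_of_var_ne_zero x one_ne_zero,
    lintegral_withDensity_eq_lintegral_mul _ (measurable_gaussianPDF x 1) (by fun_prop)]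
  rfl

instance (P : Measure ℝ) [IsProbabilityMeasure P] : IsProbabilityMeasure (jointLaw P) :=
  Measure.isProbabilityMeasure_map (by fun_prop)

theorem fst_jointLaw (P : Measure ℝ) [IsProbabilityMeasure P] : (jointLaw P).fst = P := by
  rw [Measure.fst, jointLaw, Measure.map_map measurable_fst (by fun_prop)]
  exact Measure.fst_prod

theorem snd_jointLaw (P : Measure ℝ) [IsProbabilityMeasure P] :
    (jointLaw P).snd = P.conv (gaussianReal 0 1) := by
  rw [Measure.snd, jointLaw, Measure.map_map measurable_snd (by fun_prop)]
  rfl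

theorem ofReal_outDensity (P : Measure ℝ) [IsFiniteMeasure P] (y : ℝ) :
    ENNReal.ofReal (outDensity P y) = ∫⁻ x, ENNReal.ofReal (gaussianPDFReal x 1 y) ∂P :=
  ofReal_integral_eq_lintegral_ofReal (integrable_gaussianPDFReal_left P y)
    (ae_of_all _ fun x => gaussianPDFReal_nonneg x 1 y)

theorem snd_jointLaw_eq_withDensity (P : Measure ℝ) [IsProbabilityMeasure P] :
    (jointLaw P).snd = volume.withDensity fun y => ENNReal.ofReal (outDensity P y) := by
  have hm := measurable_gaussianPDFReal_uncurry.ennreal_ofReal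
  refine Measure.ext_of_lintegral _ fun F hF => ?_
  rw [Measure.snd, lintegral_map hF measurable_snd, jointLaw_eq_withDensity,
    lintegral_withDensity_eq_lintegral_mul _ hm (by fun_prop),
    lintegral_withDensity_eq_lintegral_mul _ (measurable_outDensity P).ennreal_ofReal hF,
    lintegral_prod_symm _ (by fun_prop)]
  refine lintegral_congr fun y => ?_
  simp only [Pi.mul_apply]
  rw [lintegral_mul_const _ (by fun_prop), ofReal_outDensity]

/-- The input law is determined by the output density, because the characteristic function of the
noise has no zeros. -/
theorem eq_of_outDensity_ae_eq {P Q : Measure ℝ} [IsProbabilityMeasure P] [IsProbabilityMeasure Q]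
    (h : outDensity P =ᵐ[volume] outDensity Q) : P = Q := by
  have hconv : P.conv (gaussianReal 0 1) = Q.conv (gaussianReal 0 1) := by
    rw [← snd_jointLaw, ← snd_jointLaw, snd_jointLaw_eq_withDensity, snd_jointLaw_eq_withDensity]
    exact withDensity_congr_ae (h.mono fun y hy => by simp only [hy])
  refine Measure.ext_of_charFun (funext fun t => ?_)
  have ht := congrArg (fun μ => charFun μ t) hconv
  simp only [charFun_conv, charFun_gaussianReal] at ht
  exact mul_right_cancel₀ (Complex.exp_ne_zero _) ht

section Info

variable {A : ℝ} {P : Measure ℝ}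

/-- The joint law has density `φ(y - x) / f(y)` relative to the product of its marginals, where
`f` is the output density. -/
theorem IsInput.jointLaw_eq_withDensity_prod (hP : IsInput A P) :
    jointLaw P = ((jointLaw P).fst.prod (jointLaw P).snd).withDensity
      fun p => ENNReal.ofReal (gaussianPDFReal p.1 1 p.2 / outDensity P p.2) := by
  have := hP.1
  have hf := measurable_outDensity P
  have hg := measurable_gaussianPDFReal_uncurry
  rw [fst_jointLaw, snd_jointLaw_eq_withDensity, prod_withDensity_right hf.ennreal_ofReal,
    ← withDensity_mul _ (by fun_prop) (by fun_prop), jointLaw_eq_withDensity]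
  congr 1
  funext p
  have hpos := hP.outDensity_pos p.2
  simp only [Pi.mul_apply]
  rw [← ENNReal.ofReal_mul hpos.le, mul_div_cancel₀ _ hpos.ne']

theorem IsInput.jointLaw_absolutelyContinuous (hP : IsInput A P) :
    jointLaw P ≪ (jointLaw P).fst.prod (jointLaw P).snd := by
  conv_lhs => rw [hP.jointLaw_eq_withDensity_prod]
  exact withDensity_absolutelyContinuous _ _

theorem IsInput.llr_jointLaw (hP : IsInput A P) :
    llr (jointLaw P) ((jointLaw P).fst.prod (jointLaw P).snd) =ᵐ[jointLaw P]
      fun p => (Real.log peak - (p.2 - p.1) ^ 2 / 2) + surprisal P p.2 := by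
  have := hP.1
  have hf := measurable_outDensity P
  have hg := measurable_gaussianPDFReal_uncurry
  have hrn := Measure.rnDeriv_withDensity ((jointLaw P).fst.prod (jointLaw P).snd)
    (f := fun p => ENNReal.ofReal (gaussianPDFReal p.1 1 p.2 / outDensity P p.2)) (by fun_prop)
  rw [← hP.jointLaw_eq_withDensity_prod] at hrn
  filter_upwards [hP.jointLaw_absolutelyContinuous.ae_le hrn] with p hp
  have hpos := hP.outDensity_pos p.2
  rw [llr, hp, ENNReal.toReal_ofReal (div_nonneg (gaussianPDFReal_nonneg _ _ _) hpos.le),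
    Real.log_div (gaussianPDFReal_pos _ _ _ one_ne_zero).ne' hpos.ne', gaussianPDFReal_one,
    Real.log_mul peak_pos.ne' (Real.exp_pos _).ne', Real.log_exp, surprisal]
  ring

theorem integrable_sq_gaussianReal (x : ℝ) : Integrable (fun z : ℝ => z ^ 2) (gaussianReal x 1) :=
  (memLp_id_gaussianReal 2).integrable_sq

theorem integral_sq_gaussianReal : ∫ z : ℝ, z ^ 2 ∂gaussianReal 0 1 = 1 := by
  have h := variance_id_gaussianReal (μ := 0) (v := 1)
  rw [variance_eq_integral aemeasurable_id] at h
  simpa using h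

theorem integrable_noise_sq (P : Measure ℝ) [IsProbabilityMeasure P] :
    Integrable (fun p : ℝ × ℝ => (p.2 - p.1) ^ 2) (jointLaw P) := by
  rw [jointLaw, integrable_map_measure (by fun_prop) (by fun_prop)]
  refine ((integrable_sq_gaussianReal 0).comp_snd P).congr (ae_of_all _ fun p => ?_)
  simp

theorem integrable_log_noise (P : Measure ℝ) [IsProbabilityMeasure P] :
    Integrable (fun p : ℝ × ℝ => Real.log peak - (p.2 - p.1) ^ 2 / 2) (jointLaw P) :=
  (integrable_const _).sub ((integrable_noise_sq P).div_const 2)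

theorem integral_noise_sq (P : Measure ℝ) [IsProbabilityMeasure P] :
    ∫ p : ℝ × ℝ, (p.2 - p.1) ^ 2 ∂jointLaw P = 1 := by
  rw [jointLaw, integral_map (by fun_prop) (by fun_prop)]
  simp only [add_sub_cancel_left]
  rw [integral_fun_snd (fun z : ℝ => z ^ 2), integral_sq_gaussianReal]
  simp

theorem IsInput.integrable_surprisal_jointLaw (hP : IsInput A P) :
    Integrable (fun p : ℝ × ℝ => surprisal P p.2) (jointLaw P) := by
  have := hP.1
  have hs := measurable_surprisal P
  have h : Integrable (surprisal P) (jointLaw P).snd := by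
    rw [snd_jointLaw_eq_withDensity, integrable_withDensity_iff
      (measurable_outDensity P).ennreal_ofReal (ae_of_all _ fun _ => ENNReal.ofReal_lt_top)]
    refine (hP.integrable_surprisal_mul hP).congr (ae_of_all _ fun y => ?_)
    simp only [ENNReal.toReal_ofReal (hP.outDensity_pos y).le]
  exact h.comp_measurable measurable_snd

theorem IsInput.integral_surprisal_jointLaw (hP : IsInput A P) :
    ∫ p : ℝ × ℝ, surprisal P p.2 ∂jointLaw P = crossEntropy P P := by
  have := hP.1
  have hs := measurable_surprisal P
  rw [← integral_map (φ := Prod.snd) (f := surprisal P) (by fun_prop) (by fun_prop)]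
  change ∫ y, surprisal P y ∂(jointLaw P).snd = _
  rw [snd_jointLaw_eq_withDensity, integral_withDensity_eq_integral_toReal_smul
    (measurable_outDensity P).ennreal_ofReal (ae_of_all _ fun _ => ENNReal.ofReal_lt_top)]
  refine integral_congr_ae (ae_of_all _ fun y => ?_)
  simp only [ENNReal.toReal_ofReal (hP.outDensity_pos y).le, smul_eq_mul]
  ring

theorem IsInput.info_ne_top (hP : IsInput A P) : info P ≠ ⊤ := by
  have := hP.1
  refine InformationTheory.klDiv_ne_top hP.jointLaw_absolutelyContinuous ?_
  exact ((integrable_log_noise P).add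
    hP.integrable_surprisal_jointLaw).congr hP.llr_jointLaw.symm

/-- The mutual information is the differential entropy of the output minus that of the noise,
`log √(2πe) = 1 / 2 - log peak`. -/
theorem IsInput.toReal_info (hP : IsInput A P) :
    (info P).toReal = crossEntropy P P + (Real.log peak - 1 / 2) := by
  have := hP.1
  rw [info, mutualInfo, InformationTheory.toReal_klDiv_of_measure_eq
    hP.jointLaw_absolutelyContinuous (by simp), integral_congr_ae hP.llr_jointLaw,
    integral_add (integrable_log_noise P) hP.integrable_surprisal_jointLaw,
    integral_sub (integrable_const _) ((integrable_noise_sq P).div_const 2),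
    integral_div, integral_noise_sq, hP.integral_surprisal_jointLaw]
  simp
  ring

theorem IsInput.info_le_info_iff {Q : Measure ℝ} (hP : IsInput A P) (hQ : IsInput A Q) :
    info P ≤ info Q ↔ crossEntropy P P ≤ crossEntropy Q Q := by
  rw [← ENNReal.toReal_le_toReal hP.info_ne_top hQ.info_ne_top, hP.toReal_info, hQ.toReal_info]
  exact add_le_add_iff_right _

end Info

/-! ### Gibbs' inequality and strict concavity -/

section Gibbs

variable {A : ℝ} {P Q : Measure ℝ}

/-- The excess in Gibbs' inequality is the integral of a nonnegative function; the terms `1 - t` of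
`klFun t = t log t + 1 - t` cancel because both densities have integral one. -/
theorem IsInput.integral_klFun (hP : IsInput A P) (hQ : IsInput A Q) :
    Integrable (fun y => outDensity Q y *
      InformationTheory.klFun (outDensity P y / outDensity Q y)) ∧
    ∫ y, outDensity Q y * InformationTheory.klFun (outDensity P y / outDensity Q y) =
      crossEntropy P Q - crossEntropy P P := by
  have heq : (fun y => outDensity Q y *
      InformationTheory.klFun (outDensity P y / outDensity Q y)) = fun y =>
      (surprisal Q y * outDensity P y - surprisal P y * outDensity P y) +
        (outDensity Q y - outDensity P y) := by
    funext y
    have hp := hP.outDensity_pos y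
    have hq := hQ.outDensity_pos y
    rw [InformationTheory.klFun_apply, Real.log_div hp.ne' hq.ne', surprisal, surprisal]
    field_simp
    ring
  have h1 : Integrable fun y =>
      surprisal Q y * outDensity P y - surprisal P y * outDensity P y :=
    (hP.integrable_surprisal_mul hQ).sub (hP.integrable_surprisal_mul hP)
  have h2 : Integrable fun y => outDensity Q y - outDensity P y :=
    hQ.integrable_outDensity.sub hP.integrable_outDensity
  rw [heq]
  refine ⟨h1.add h2, ?_⟩
  rw [integral_add h1 h2, integral_sub (hP.integrable_surprisal_mul hQ)
    (hP.integrable_surprisal_mul hP), integral_sub hQ.integrable_outDensity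
    hP.integrable_outDensity, hP.integral_outDensity, hQ.integral_outDensity, sub_self, add_zero]
  rfl

theorem IsInput.klFun_outDensity_nonneg (hP : IsInput A P) (hQ : IsInput A Q) (y : ℝ) :
    0 ≤ outDensity Q y * InformationTheory.klFun (outDensity P y / outDensity Q y) :=
  mul_nonneg (hQ.outDensity_pos y).le (InformationTheory.klFun_nonneg
    (div_nonneg (hP.outDensity_pos y).le (hQ.outDensity_pos y).le))

/-- Gibbs' inequality for output laws. -/
theorem IsInput.crossEntropy_self_le (hP : IsInput A P) (hQ : IsInput A Q) :
    crossEntropy P P ≤ crossEntropy P Q := by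
  rw [← sub_nonneg, ← (hP.integral_klFun hQ).2]
  exact integral_nonneg (hP.klFun_outDensity_nonneg hQ)

/-- The equality case of Gibbs' inequality. -/
theorem IsInput.outDensity_ae_eq (hP : IsInput A P) (hQ : IsInput A Q)
    (h : crossEntropy P Q ≤ crossEntropy P P) : outDensity P =ᵐ[volume] outDensity Q := by
  obtain ⟨hint, heq⟩ := hP.integral_klFun hQ
  have h0 := (integral_eq_zero_iff_of_nonneg (hP.klFun_outDensity_nonneg hQ) hint).1
    (le_antisymm (heq.trans_le (sub_nonpos.2 h)) (integral_nonneg (hP.klFun_outDensity_nonneg hQ)))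
  filter_upwards [h0] with y hy
  have hq := hQ.outDensity_pos y
  have hy' := (mul_eq_zero.1 hy).resolve_left hq.ne'
  rw [InformationTheory.klFun_eq_zero_iff (div_nonneg (hP.outDensity_pos y).le hq.le)] at hy'
  exact (div_eq_one_iff_eq hq.ne').1 hy'

end Gibbs

/-- The mixture `(1 - t) P + t Q`, for `0 ≤ t ≤ 1`. -/
noncomputable def mix (t : ℝ) (P Q : Measure ℝ) : Measure ℝ :=
  ENNReal.ofReal (1 - t) • P + ENNReal.ofReal t • Q

section Mix

variable {A t : ℝ} {P Q R : Measure ℝ}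

theorem IsInput.mix (hP : IsInput A P) (hQ : IsInput A Q) (ht : t ∈ Icc (0 : ℝ) 1) :
    IsInput A (mix t P Q) := by
  rw [isInput_iff_ae] at hP hQ ⊢
  have := hP.1
  have := hQ.1
  refine ⟨⟨?_⟩, ?_⟩
  · simp only [AmplitudeAWGN.mix, Measure.add_apply, Measure.smul_apply, measure_univ, smul_eq_mul,
      mul_one]
    rw [← ENNReal.ofReal_add (sub_nonneg.2 ht.2) ht.1]
    simp
  · rw [AmplitudeAWGN.mix, ae_add_measure_iff]
    exact ⟨Measure.ae_smul_measure hP.2 _, Measure.ae_smul_measure hQ.2 _⟩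

theorem outDensity_mix [IsFiniteMeasure P] [IsFiniteMeasure Q] (ht : t ∈ Icc (0 : ℝ) 1) (y : ℝ) :
    outDensity (mix t P Q) y = (1 - t) * outDensity P y + t * outDensity Q y := by
  rw [outDensity, mix, integral_add_measure
    ((integrable_gaussianPDFReal_left P y).smul_measure ENNReal.ofReal_ne_top)
    ((integrable_gaussianPDFReal_left Q y).smul_measure ENNReal.ofReal_ne_top),
    integral_smul_measure, integral_smul_measure, ENNReal.toReal_ofReal (sub_nonneg.2 ht.2),
    ENNReal.toReal_ofReal ht.1]
  rfl

theorem IsInput.crossEntropy_mix (hP : IsInput A P) (hQ : IsInput A Q) (hR : IsInput A R)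
    (ht : t ∈ Icc (0 : ℝ) 1) :
    crossEntropy (AmplitudeAWGN.mix t P Q) R =
      (1 - t) * crossEntropy P R + t * crossEntropy Q R := by
  have := hP.1
  have := hQ.1
  simp only [crossEntropy]
  rw [← integral_const_mul, ← integral_const_mul, ← integral_add
    ((hP.integrable_surprisal_mul hR).const_mul _) ((hQ.integrable_surprisal_mul hR).const_mul _)]
  refine integral_congr_ae (ae_of_all _ fun y => ?_)
  simp only [outDensity_mix ht]
  ring

/-- Output entropy is strictly concave in the input law, so it has at most one maximizer. -/
theorem IsInput.eq_of_forall_le (hP : IsInput A P) (hQ : IsInput A Q)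
    (hPmax : ∀ R, IsInput A R → crossEntropy R R ≤ crossEntropy P P)
    (hQmax : ∀ R, IsInput A R → crossEntropy R R ≤ crossEntropy Q Q) : P = Q := by
  have ht : (1 / 2 : ℝ) ∈ Icc (0 : ℝ) 1 := by constructor <;> norm_num
  have hM := hP.mix hQ ht
  have hmix := hP.crossEntropy_mix hQ hM ht
  have h1 := hP.crossEntropy_self_le hM
  have h2 := hQ.crossEntropy_self_le hM
  have h3 := hPmax _ hM
  have h4 := hPmax _ hQ
  have h5 := hQmax _ hP
  have hPM := hP.outDensity_ae_eq hM (by linarith)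
  have hQM := hQ.outDensity_ae_eq hM (by linarith)
  have := hP.1
  have := hQ.1
  exact eq_of_outDensity_ae_eq (hPM.trans hQM.symm)

end Mix

/-! ### Continuity, first-order optimality and compactness -/

section Continuity

variable {A : ℝ} {P Q : Measure ℝ}

/-- Cross entropy is continuous under pointwise convergence of the output densities, the inputs
being confined to a fixed interval. -/
theorem tendsto_crossEntropy {ι : Type*} {l : Filter ι} [l.IsCountablyGenerated]
    {p q : ι → Measure ℝ} (hp : ∀ᶠ i in l, IsInput A (p i)) (hq : ∀ᶠ i in l, IsInput A (q i))
    (hQ : IsInput A Q)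
    (hpP : ∀ y, Tendsto (fun i => outDensity (p i) y) l (𝓝 (outDensity P y)))
    (hqQ : ∀ y, Tendsto (fun i => outDensity (q i) y) l (𝓝 (outDensity Q y))) :
    Tendsto (fun i => crossEntropy (p i) (q i)) l (𝓝 (crossEntropy P Q)) := by
  refine tendsto_integral_filter_of_dominated_convergence
    (fun y => ((A ^ 2 - Real.log peak) + y ^ 2) * (peak * Real.exp (A ^ 2 / 2 - y ^ 2 / 4)))
    ?_ ?_ (integrable_quadratic_mul_envelope _ A) (ae_of_all _ fun y => ?_)
  · filter_upwards [hp, hq] with i hpi hqi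
    have := hpi.1
    have := hqi.1
    exact ((measurable_surprisal _).mul (measurable_outDensity _)).aestronglyMeasurable
  · filter_upwards [hp, hq] with i hpi hqi
    refine ae_of_all _ fun y => ?_
    rw [norm_mul, Real.norm_eq_abs, Real.norm_of_nonneg (hpi.outDensity_pos y).le]
    exact mul_le_mul (hqi.abs_surprisal_le y) (hpi.outDensity_le y) (hpi.outDensity_pos y).le
      ((abs_nonneg _).trans (hqi.abs_surprisal_le y))
  · exact ((hqQ y).log (hQ.outDensity_pos y).ne').neg.mul (hpP y)

/-- The first-order optimality condition: at a maximizer `P` of the output entropy, the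
directional derivative towards any other input `Q` is nonpositive. -/
theorem IsInput.crossEntropy_le_of_forall_le (hP : IsInput A P) (hQ : IsInput A Q)
    (hPmax : ∀ R, IsInput A R → crossEntropy R R ≤ crossEntropy P P) :
    crossEntropy Q P ≤ crossEntropy P P := by
  have := hP.1
  have := hQ.1
  have hmem : ∀ᶠ t : ℝ in 𝓝[>] 0, t ∈ Ioc (0 : ℝ) 1 := Ioc_mem_nhdsGT one_pos
  have hlim : Tendsto (fun t : ℝ => crossEntropy Q (AmplitudeAWGN.mix t P Q)) (𝓝[>] 0)
      (𝓝 (crossEntropy Q P)) := by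
    refine tendsto_crossEntropy (Eventually.of_forall fun _ => hQ)
      (hmem.mono fun t ht => hP.mix hQ ⟨ht.1.le, ht.2⟩) hP (fun y => tendsto_const_nhds)
      fun y => ?_
    have h0 : Tendsto (fun t : ℝ => (1 - t) * outDensity P y + t * outDensity Q y) (𝓝[>] 0)
        (𝓝 ((1 - 0) * outDensity P y + 0 * outDensity Q y)) :=
      (Continuous.tendsto (by fun_prop) 0).mono_left nhdsWithin_le_nhds
    rw [sub_zero, one_mul, zero_mul, add_zero] at h0
    exact h0.congr' (hmem.mono fun t ht => (outDensity_mix ⟨ht.1.le, ht.2⟩ y).symm)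
  refine le_of_tendsto hlim (hmem.mono fun t ht => ?_)
  have ht' : t ∈ Icc (0 : ℝ) 1 := ⟨ht.1.le, ht.2⟩
  have hM := hP.mix hQ ht'
  have h1 := hPmax _ hM
  rw [hP.crossEntropy_mix hQ hM ht'] at h1
  have h2 := mul_le_mul_of_nonneg_left (hP.crossEntropy_self_le hM) (sub_nonneg.2 ht.2)
  refine le_of_mul_le_mul_left ?_ ht.1
  linarith

/-- The probability laws on `[-A, A]`, inside the space of probability measures with the topology
of weak convergence. -/
def inputs (A : ℝ) : Set (ProbabilityMeasure ℝ) := {P | IsInput A P}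

theorem isCompact_inputs (A : ℝ) : IsCompact (inputs A) := by
  have h := isCompact_setOfPred_probabilityMeasure_mass_eq_compl_isCompact_le
    (E := ℝ) (u := fun _ => 0) (K := fun _ => Icc (-A) A) tendsto_const_nhds
    (fun _ => isCompact_Icc) (Or.inr monotone_const)
  convert h using 1
  ext P
  simp only [inputs, mem_ofPred_eq, forall_const, nonpos_iff_eq_zero,
    ProbabilityMeasure.null_iff_toMeasure_null]
  rw [isInput_iff_ae, ae_iff]
  refine (and_iff_right (inferInstanceAs (IsProbabilityMeasure (P : Measure ℝ)))).trans ?_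
  have : {x : ℝ | ¬ |x| ≤ A} = (Icc (-A) A)ᶜ := by
    ext x
    simp only [mem_ofPred_eq, mem_compl_iff, mem_Icc, abs_le]
  rw [this]

theorem continuousOn_crossEntropy (A : ℝ) :
    ContinuousOn (fun P : ProbabilityMeasure ℝ => crossEntropy P P) (inputs A) := by
  intro P hP
  have hy : ∀ y, Tendsto (fun R : ProbabilityMeasure ℝ => outDensity R y) (𝓝[inputs A] P)
      (𝓝 (outDensity P y)) := fun y => by
    have hc : Continuous fun x => gaussianPDFReal x 1 y := by
      simp only [gaussianPDFReal_one]
      fun_prop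
    have h := ProbabilityMeasure.continuous_integral_boundedContinuousFunction
      (BoundedContinuousFunction.ofNormedAddCommGroup _ hc peak fun x => by
        rw [Real.norm_of_nonneg (gaussianPDFReal_nonneg _ _ _)]
        exact gaussianPDFReal_le_peak x y)
    exact (h.tendsto P).mono_left nhdsWithin_le_nhds
  exact tendsto_crossEntropy self_mem_nhdsWithin self_mem_nhdsWithin hP hy hy

theorem exists_isMaxOn_inputs (hA : 0 ≤ A) :
    ∃ P, IsInput A P ∧ ∀ R, IsInput A R → crossEntropy R R ≤ crossEntropy P P := by
  have h0 : IsInput A (Measure.dirac 0) := isInput_dirac (by simpa using hA)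
  obtain ⟨P, hP, hmax⟩ := (isCompact_inputs A).exists_isMaxOn
    ⟨⟨Measure.dirac 0, inferInstance⟩, h0⟩ (continuousOn_crossEntropy A)
  exact ⟨P, hP, fun R hR => hmax (show (⟨R, hR.1⟩ : ProbabilityMeasure ℝ) ∈ inputs A from hR)⟩

end Continuity

/-! ### Finite support of maximizers -/

section FiniteSupport

variable {A : ℝ} {P : Measure ℝ}

theorem IsInput.integrable_surprisal_mul_gaussianPDFReal (hP : IsInput A P) (x : ℝ) :
    Integrable fun y => surprisal P y * gaussianPDFReal x 1 y := by
  -- The bounds need a common interval for `P` and the point mass at `x`.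
  have h := (isInput_dirac (le_max_right A |x|)).integrable_surprisal_mul
    (hP.mono (le_max_left A |x|))
  simpa only [outDensity_dirac] using h

theorem gaussianPDFReal_eq_exp_mul (x y : ℝ) :
    gaussianPDFReal x 1 y =
      Real.exp (-x ^ 2 / 2) * (Real.exp (x * y) * gaussianPDFReal 0 1 y) := by
  rw [gaussianPDFReal_one, gaussianPDFReal_one,
    show -(y - x) ^ 2 / 2 = -x ^ 2 / 2 + (x * y + -(y - 0) ^ 2 / 2) by ring, Real.exp_add,
    Real.exp_add]
  ring

/-- Up to the factor `exp (-x² / 2)`, the cross entropy at the point mass in `x` is the moment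
generating function of a measure all of whose exponential moments are finite. -/
theorem IsInput.analyticOnNhd_crossEntropy_dirac (hP : IsInput A P) :
    AnalyticOnNhd ℝ (fun x => crossEntropy (Measure.dirac x) P) univ := by
  have := hP.1
  set w : ℝ → ℝ≥0∞ := fun y => ENNReal.ofReal (surprisal P y * gaussianPDFReal 0 1 y) with hw
  have hwm : Measurable w :=
    ((measurable_surprisal P).mul (measurable_gaussianPDFReal 0 1)).ennreal_ofReal
  have hw_toReal : ∀ y, (w y).toReal = surprisal P y * gaussianPDFReal 0 1 y := fun y =>
    ENNReal.toReal_ofReal (mul_nonneg (hP.surprisal_nonneg y) (gaussianPDFReal_nonneg _ _ _))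
  have hw_top : ∀ᵐ y : ℝ, w y < ⊤ := ae_of_all _ fun _ => ENNReal.ofReal_lt_top
  have hset : integrableExpSet id (volume.withDensity w) = univ := by
    refine eq_univ_of_forall fun x => ?_
    change Integrable (fun y => Real.exp (x * id y)) (volume.withDensity w)
    rw [integrable_withDensity_iff hwm hw_top]
    refine ((hP.integrable_surprisal_mul_gaussianPDFReal x).const_mul
      (Real.exp (x ^ 2 / 2))).congr (ae_of_all _ fun y => ?_)
    have hexp : Real.exp (x ^ 2 / 2) * Real.exp (-x ^ 2 / 2) = 1 := by
      rw [← Real.exp_add, ← Real.exp_zero]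
      congr 1
      ring
    simp only [hw_toReal, gaussianPDFReal_eq_exp_mul x y, id]
    linear_combination (surprisal P y * Real.exp (x * y) * gaussianPDFReal 0 1 y) * hexp
  have hmgf : AnalyticOnNhd ℝ (mgf id (volume.withDensity w)) univ := by
    have h := analyticOnNhd_mgf (X := id) (μ := volume.withDensity w)
    rwa [hset, interior_univ] at h
  have heq : (fun x => crossEntropy (Measure.dirac x) P) =
      fun x => Real.exp (-x ^ 2 / 2) * mgf id (volume.withDensity w) x := by
    funext x
    rw [mgf, integral_withDensity_eq_integral_toReal_smul hwm hw_top, crossEntropy,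
      ← integral_const_mul]
    refine integral_congr_ae (ae_of_all _ fun y => ?_)
    simp only [hw_toReal, outDensity_dirac, gaussianPDFReal_eq_exp_mul x y, smul_eq_mul, id]
    ring
  rw [heq]
  refine AnalyticOnNhd.mul (fun x _ => ?_) hmgf
  fun_prop

theorem sq_le_integral_sq_gaussianReal (x : ℝ) : x ^ 2 ≤ ∫ y, y ^ 2 ∂gaussianReal x 1 := by
  have hid : Integrable (fun y : ℝ => y) (gaussianReal x 1) :=
    (memLp_id_gaussianReal (μ := x) (v := 1) 1).integrable le_rfl
  -- `y²` dominates its tangent `2xy - x²` at the mean `x`.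
  have hlin : Integrable (fun y : ℝ => 2 * x * y - x ^ 2) (gaussianReal x 1) :=
    (hid.const_mul (2 * x)).sub (integrable_const _)
  have h := integral_mono hlin (integrable_sq_gaussianReal x) fun y => by
    nlinarith [sq_nonneg (y - x)]
  rw [integral_sub (hid.const_mul _) (integrable_const _), integral_const_mul,
    integral_id_gaussianReal] at h
  simp only [integral_const, probReal_univ, one_smul] at h
  linarith

theorem IsInput.le_crossEntropy_dirac (hP : IsInput A P) (x : ℝ) :
    x ^ 2 / 4 - A ^ 2 / 2 - Real.log peak ≤ crossEntropy (Measure.dirac x) P := by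
  have h1 : crossEntropy (Measure.dirac x) P = ∫ y, surprisal P y ∂gaussianReal x 1 := by
    rw [integral_gaussianReal_eq_integral_smul one_ne_zero]
    refine integral_congr_ae (ae_of_all _ fun y => ?_)
    simp only [outDensity_dirac, smul_eq_mul]
    ring
  have hs : Integrable (surprisal P) (gaussianReal x 1) := by
    rw [gaussianReal_of_var_ne_zero x one_ne_zero, integrable_withDensity_iff
      (measurable_gaussianPDF x 1) (ae_of_all _ fun _ => gaussianPDF_lt_top)]
    simpa only [toReal_gaussianPDF] using hP.integrable_surprisal_mul_gaussianPDFReal x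
  have hq : Integrable (fun y : ℝ => y ^ 2 / 4 - (A ^ 2 / 2 + Real.log peak)) (gaussianReal x 1) :=
    ((integrable_sq_gaussianReal x).div_const 4).sub (integrable_const _)
  have h2 := integral_mono hq hs fun y => by linarith [hP.le_surprisal y]
  rw [integral_sub ((integrable_sq_gaussianReal x).div_const 4) (integrable_const _),
    integral_div] at h2
  have h3 := sq_le_integral_sq_gaussianReal x
  simp only [integral_const, probReal_univ, one_smul] at h2
  linarith

/-- At a maximizer `P`, averaging over `x ∼ P` turns the first-order condition into an equality, so
the cross entropy at the point masses equals its maximum on all of the support. -/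
theorem IsInput.crossEntropy_dirac_eq_of_mem_support (hP : IsInput A P)
    (hPmax : ∀ R, IsInput A R → crossEntropy R R ≤ crossEntropy P P) {x : ℝ}
    (hx : x ∈ P.support) : crossEntropy (Measure.dirac x) P = crossEntropy P P := by
  have := hP.1
  have hle : ∀ᵐ z ∂P, 0 ≤ crossEntropy P P - crossEntropy (Measure.dirac z) P :=
    (isInput_iff_ae.1 hP).2.mono fun z hz =>
      sub_nonneg.2 (hP.crossEntropy_le_of_forall_le (isInput_dirac hz) hPmax)
  have hint := hP.integrable_crossEntropy_dirac hP
  have h0 : ∫ z, (crossEntropy P P - crossEntropy (Measure.dirac z) P) ∂P = 0 := by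
    rw [integral_sub (integrable_const _) hint, ← hP.crossEntropy_eq_integral_dirac hP]
    simp
  have hae := (integral_eq_zero_iff_of_nonneg_ae hle ((integrable_const _).sub hint)).1 h0
  have hcont : Continuous fun z => crossEntropy (Measure.dirac z) P :=
    continuousOn_univ.1 hP.analyticOnNhd_crossEntropy_dirac.continuousOn
  have hclosed : IsClosed {z | crossEntropy (Measure.dirac z) P = crossEntropy P P} :=
    isClosed_eq hcont continuous_const
  exact Measure.support_subset_of_isClosed hclosed (hae.mono fun z hz => (sub_eq_zero.1 hz).symm) hx

/-- A maximizer has finite support: otherwise the identity theorem would make the cross entropy at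
the point masses constant on `ℝ`, whereas it grows quadratically. -/
theorem IsInput.finite_support (hP : IsInput A P)
    (hPmax : ∀ R, IsInput A R → crossEntropy R R ≤ crossEntropy P P) : P.support.Finite := by
  by_contra hinf
  obtain ⟨z, -, hz⟩ := Set.Infinite.exists_accPt_of_subset_isCompact hinf isCompact_Icc hP.2
  have hfreq : ∃ᶠ x in 𝓝[≠] z, crossEntropy (Measure.dirac x) P = crossEntropy P P :=
    (accPt_iff_frequently_nhdsNE.1 hz).mono fun x hx =>
      hP.crossEntropy_dirac_eq_of_mem_support hPmax hx
  have hconst := hP.analyticOnNhd_crossEntropy_dirac.eqOn_of_preconnected_of_frequently_eq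
    (analyticOnNhd_const (v := crossEntropy P P)) isPreconnected_univ (mem_univ z) hfreq
  have hlim : Tendsto (fun x : ℝ => x ^ 2 / 4 - A ^ 2 / 2 - Real.log peak) atTop atTop :=
    tendsto_atTop_add_const_right _ _ (tendsto_atTop_add_const_right _ _
      ((tendsto_pow_atTop two_ne_zero).atTop_div_const (by norm_num)))
  obtain ⟨x, hx⟩ := (hlim.eventually_gt_atTop (crossEntropy P P)).exists
  exact absurd (hconst (mem_univ x)) (hx.trans_le (hP.le_crossEntropy_dirac x)).ne'

end FiniteSupport

/-! ### Support sizes of nearly optimal inputs -/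

section SupportSize

variable {A : ℝ} {P : Measure ℝ}

/-- A weak limit of laws that do not charge an open set does not charge it either, by the
portmanteau theorem. -/
theorem isClosed_measure_eq_zero {U : Set ℝ} (hU : IsOpen U) :
    IsClosed {Q : ProbabilityMeasure ℝ | (Q : Measure ℝ) U = 0} := by
  refine isClosed_of_closure_subset fun Q hQ => ?_
  have := mem_closure_iff_nhdsWithin_neBot.1 hQ
  have h := ProbabilityMeasure.le_liminf_measure_open_of_tendsto (μs := fun R => R)
    (tendsto_id.mono_left nhdsWithin_le_nhds :
      Tendsto (fun R => R) (𝓝[{Q : ProbabilityMeasure ℝ | (Q : Measure ℝ) U = 0}] Q) (𝓝 Q)) hU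
  refine le_antisymm (h.trans ?_) zero_le
  have h0 : ∀ᶠ R : ProbabilityMeasure ℝ in 𝓝[{Q | (Q : Measure ℝ) U = 0}] Q,
      (R : Measure ℝ) U = 0 := eventually_mem_nhdsWithin
  rw [liminf_congr h0, liminf_const]

/-- Laws whose output entropy is close to the maximum have at least as many support points as the
maximizer: by uniqueness and compactness they are weakly close to it, so they charge disjoint
neighbourhoods of its support points. -/
theorem IsInput.exists_forall_encard_support_le (hP : IsInput A P)
    (hPmax : ∀ R, IsInput A R → crossEntropy R R ≤ crossEntropy P P) :
    ∃ δ > 0, ∀ Q, IsInput A Q → crossEntropy P P - δ < crossEntropy Q Q →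
      P.support.encard ≤ Q.support.encard := by
  have hfin := hP.finite_support hPmax
  obtain ⟨U, hU, hdisj⟩ := hfin.t2_separation
  -- The inputs that miss one of the neighbourhoods form a compact set not containing `P`.
  set F : Set (ProbabilityMeasure ℝ) :=
    inputs A ∩ ⋃ x ∈ P.support, {Q | (Q : Measure ℝ) (U x) = 0} with hF
  have hFc : IsCompact F := (isCompact_inputs A).inter_right
    (hfin.isClosed_biUnion fun x _ => isClosed_measure_eq_zero (hU x).2)
  have hlt : ∀ Q ∈ F, crossEntropy Q Q < crossEntropy P P := by
    rintro Q ⟨hQ, hQF⟩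
    refine (hPmax Q hQ).lt_of_ne fun heq => ?_
    obtain rfl : P = Q := hP.eq_of_forall_le hQ hPmax (heq ▸ hPmax)
    obtain ⟨x, hx, hx0⟩ := mem_iUnion₂.1 hQF
    exact ((Measure.mem_support_iff_forall x).1 hx _ ((hU x).2.mem_nhds (hU x).1)).ne' hx0
  have hgap : ∃ δ > 0, ∀ Q ∈ F, crossEntropy Q Q ≤ crossEntropy P P - δ := by
    rcases F.eq_empty_or_nonempty with hFe | hFne
    · exact ⟨1, one_pos, by simp [hFe]⟩
    · obtain ⟨Q, hQ, hQmax⟩ := hFc.exists_isMaxOn hFne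
        ((continuousOn_crossEntropy A).mono inter_subset_left)
      exact ⟨crossEntropy P P - crossEntropy Q Q, sub_pos.2 (hlt Q hQ), fun R hR => by
        rw [sub_sub_cancel]
        exact hQmax hR⟩
  obtain ⟨δ, hδ, hδF⟩ := hgap
  refine ⟨δ, hδ, fun Q hQ hQδ => ?_⟩
  have hpos : ∀ x ∈ P.support, (U x ∩ Q.support).Nonempty := fun x hx => by
    refine Measure.nonempty_inter_support_of_pos (pos_iff_ne_zero.2 fun h0 => hQδ.not_ge ?_)
    exact hδF ⟨Q, hQ.1⟩ ⟨hQ, mem_iUnion₂.2 ⟨x, hx, h0⟩⟩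
  choose! f hf using hpos
  refine encard_le_encard_of_injOn (f := f) (fun x hx => (hf x hx).2) fun x hx y hy hxy => ?_
  by_contra hne
  exact disjoint_left.1 (hdisj hx hy hne) (hf x hx).1 (hxy ▸ (hf y hy).1)

theorem IsInput.one_le_encard_support (hP : IsInput A P) : 1 ≤ P.support.encard := by
  have := hP.1
  exact one_le_encard_iff_nonempty.2 (Measure.nonempty_support (IsProbabilityMeasure.ne_zero P))

theorem isDiscreteLaw_of_finite_support (h : P.support.Finite) : IsDiscreteLaw P :=
  ⟨P.support, h.countable, Measure.measure_compl_support⟩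

end SupportSize

/-! ### Capacity and the function `K` -/

section Capacity

variable {A ε : ℝ} {P Q : Measure ℝ}

theorem IsInput.info_le_capacity (hP : IsInput A P) : info P ≤ capacity A :=
  le_sSup ⟨P, hP, rfl⟩

theorem isCapacityAchieving_iff :
    IsCapacityAchieving A P ↔
      IsInput A P ∧ ∀ R, IsInput A R → crossEntropy R R ≤ crossEntropy P P := by
  refine and_congr_right fun hP => ⟨fun h R hR => ?_, fun h => ?_⟩
  · rw [← hR.info_le_info_iff hP, h]
    exact hR.info_le_capacity
  · refine le_antisymm hP.info_le_capacity (sSup_le ?_)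
    rintro _ ⟨R, hR, rfl⟩
    exact (hR.info_le_info_iff hP).2 (h R hR)

theorem exists_isCapacityAchieving (hA : 0 ≤ A) : ∃ P, IsCapacityAchieving A P :=
  (exists_isMaxOn_inputs hA).imp fun _ h => isCapacityAchieving_iff.2 h

theorem IsCapacityAchieving.unique (hP : IsCapacityAchieving A P) (hQ : IsCapacityAchieving A Q) :
    P = Q :=
  hP.1.eq_of_forall_le hQ.1 (isCapacityAchieving_iff.1 hP).2 (isCapacityAchieving_iff.1 hQ).2

theorem IsCapacityAchieving.capacity_lt_top (hP : IsCapacityAchieving A P) : capacity A < ⊤ :=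
  hP.2 ▸ hP.1.info_ne_top.lt_top

theorem IsCapacityAchieving.finite_support (hP : IsCapacityAchieving A P) : P.support.Finite :=
  hP.1.finite_support (isCapacityAchieving_iff.1 hP).2

theorem IsCapacityAchieving.mem_nearOptimalSizes (hP : IsCapacityAchieving A P) (ε : ℝ) :
    P.support.encard ∈ nearOptimalSizes ε A :=
  ⟨P, hP.1, isDiscreteLaw_of_finite_support hP.finite_support, hP.2 ▸ tsub_le_self, rfl⟩

theorem IsCapacityAchieving.K_mem (hP : IsCapacityAchieving A P) (ε : ℝ) :
    K ε A ∈ nearOptimalSizes ε A :=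
  csInf_mem ⟨_, hP.mem_nearOptimalSizes ε⟩

theorem IsCapacityAchieving.K_le (hP : IsCapacityAchieving A P) (ε : ℝ) :
    K ε A ≤ P.support.encard :=
  sInf_le (hP.mem_nearOptimalSizes ε)

theorem K_antitone (A : ℝ) : Antitone fun ε : ℝ => K ε A := by
  refine fun ε₁ ε₂ h => sInf_le_sInf ?_
  rintro _ ⟨P, hP, hd, hI, rfl⟩
  exact ⟨P, hP, hd, (tsub_le_tsub_left (ENNReal.ofReal_le_ofReal h) _).trans hI, rfl⟩

theorem IsCapacityAchieving.le_K_of_lt_gap (hP : IsCapacityAchieving A P) {m : ℕ}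
    (hε : ENNReal.ofReal ε < gap A P m) : P.support.encard - m + 1 ≤ K ε A := by
  obtain ⟨Q, hQ, hd, hI, hK⟩ := hP.K_mem ε
  rw [hK]
  refine Order.add_one_le_of_lt (not_le.1 fun hle => hε.not_ge ?_)
  have h : info Q ≤ capacityMinus A P m := le_sSup ⟨Q, hQ, hd, hle, rfl⟩
  exact tsub_le_iff_tsub_le.1 (hI.trans h)

theorem IsCapacityAchieving.eventually_K_eq (hP : IsCapacityAchieving A P) :
    ∀ᶠ ε in 𝓝[>] (0 : ℝ), K ε A = P.support.encard := by
  obtain ⟨δ, hδ, h⟩ := hP.1.exists_forall_encard_support_le (isCapacityAchieving_iff.1 hP).2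
  filter_upwards [Ioo_mem_nhdsGT hδ] with ε hε
  refine le_antisymm (hP.K_le ε) ?_
  obtain ⟨Q, hQ, -, hI, hK⟩ := hP.K_mem ε
  rw [hK]
  refine h Q hQ ?_
  have hle : info P ≤ info Q + ENNReal.ofReal ε := by
    rw [hP.2]
    exact tsub_le_iff_right.1 hI
  have hle' := ENNReal.toReal_mono (ENNReal.add_ne_top.2 ⟨hQ.info_ne_top, ENNReal.ofReal_ne_top⟩)
    hle
  rw [ENNReal.toReal_add hQ.info_ne_top ENNReal.ofReal_ne_top, ENNReal.toReal_ofReal hε.1.le,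
    hP.1.toReal_info, hQ.toReal_info] at hle'
  linarith [hε.2]

end Capacity

end AmplitudeAWGN

theorem mainTheorem4 (A : ℝ) (hA : 0 < A) :
    -- the capacity is finite and the capacity-achieving input law exists and is unique
    AmplitudeAWGN.capacity A < ⊤ ∧
    (∃! P : Measure ℝ, AmplitudeAWGN.IsCapacityAchieving A P) ∧
    ∀ Pstar : Measure ℝ, AmplitudeAWGN.IsCapacityAchieving A Pstar →
      -- (1) the minimum defining `K_ε(A)` is attained, and `1 ≤ K_ε(A) ≤ |supp P_{X*}| < ∞`
      (∀ ε : ℝ, 0 < ε →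
        IsLeast (AmplitudeAWGN.nearOptimalSizes ε A) (AmplitudeAWGN.K ε A) ∧
        1 ≤ AmplitudeAWGN.K ε A ∧
        AmplitudeAWGN.K ε A ≤ Pstar.support.encard ∧
        Pstar.support.encard < ⊤) ∧
      -- (2) `ε ↦ K_ε(A)` is non-increasing on `(0, ∞)`
      AntitoneOn (fun ε : ℝ => AmplitudeAWGN.K ε A) (Ioi 0) ∧
      -- (3) lower bound for gaps below `δ_m(A)`
      (∀ m : ℕ, 1 ≤ m → (m : ℕ∞) < Pstar.support.encard →
        ∀ ε : ℝ, 0 < ε → ENNReal.ofReal ε < AmplitudeAWGN.gap A Pstar m →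
          Pstar.support.encard - m + 1 ≤ AmplitudeAWGN.K ε A) ∧
      -- (4) limit as `ε ↓ 0`
      Tendsto (fun ε : ℝ => AmplitudeAWGN.K ε A) (𝓝[>] 0) (𝓝 Pstar.support.encard) := by
  obtain ⟨P, hP⟩ := AmplitudeAWGN.exists_isCapacityAchieving hA.le
  refine ⟨hP.capacity_lt_top, ⟨P, hP, fun Q hQ => hQ.unique hP⟩, fun Q hQ => ?_⟩
  refine ⟨fun ε _ => ⟨⟨hQ.K_mem ε, fun k hk => sInf_le hk⟩, ?_, hQ.K_le ε,
      encard_lt_top_iff.2 hQ.finite_support⟩,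
    (AmplitudeAWGN.K_antitone A).antitoneOn _, fun m _ _ ε _ hε => hQ.le_K_of_lt_gap hε,
    tendsto_nhds_of_eventually_eq hQ.eventually_K_eq⟩
  obtain ⟨R, hR, -, -, hK⟩ := hQ.K_mem ε
  exact hK ▸ hR.one_le_encard_support
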